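/- Let $M\subset\mathbb{R}^n$ be a closed subset that is a smooth ($C^\infty$) embedded submanifold without boundary (components of different dimensions are allowed). For $r>0$ let $N_r(M)=\{(p,v) : p\in M,\ v\perp T_pM,\ \|v\|<r\}$ be its normal bundle of radius $r$, and let $\mathrm{reach}(M)\in[-\infty,\infty]$ be the supremum of all $r>0$ for which $(p,v)\mapsto p+v$ is a smooth embedding of $N_r(M)$ into $\mathbb{R}^n$ (with $\sup\emptyset=-\infty$). Write $D_\alpha(M)=\{y\in\mathbb{R}^n : d(y,M)\le\alpha\}$, write $B_\rho(x)$ for the open ball of radius $\rho$ about $x$, and let $H_\ell$ denote relative singular homology with coefficients in $\mathbb{Z}$. Let $0<\alpha<\mathrm{reach}(M)$, $\alpha<\rho<2\,\mathrm{reach}(M)-\alpha$ and $x\in M$. Then for every $\ell\ge 0$ the inclusions $(M, M-B_\rho(x))\hookrightarrow (D_\alpha(M), D_\alpha(M)-B_\rho(x))$ and $(M,M-B_\rho(x))\hookrightarrow (M,M-\{x\})$ induce isomorphisms $$H_\ell(D_\alpha(M),D_\alpha(M)-B_\rho(x))\;\cong\; H_\ell(M,M-B_\rho(x))\;\cong\;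 H_\ell(M,M-\{x\}).$$ -/

import Mathlib

open CategoryTheory CategoryTheory.Limits
open scoped ContDiff Topology

noncomputable section

namespace ReachHom

/-! ### Singular homology of pairs -/

/-- The singular chain complex functor with integer coefficients. -/
abbrev singularChains : TopCat.{0} ⥤ ChainComplex (ModuleCat.{0} ℤ) ℕ :=
  (AlgebraicTopology.singularChainComplexFunctor (ModuleCat.{0} ℤ)).obj (ModuleCat.of ℤ ℤ)

/-- The relative singular chain complex `C(X, A) = C(X) / C(A)` of a pair `(X, A)`. -/
def relChains (P : TopPair.{0}) : ChainComplex (ModuleCat.{0} ℤ) ℕ :=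
  cokernel (singularChains.map P.map)

/-- The chain map `C(X, A) ⟶ C(Y, B)` induced by a map of pairs. -/
def relChainsMap {P Q : TopPair.{0}} (f : P ⟶ Q) : relChains P ⟶ relChains Q :=
  cokernel.map _ _ (singularChains.map (TopPair.Hom.snd f)) (singularChains.map (TopPair.Hom.fst f))
    (by rw [← Functor.map_comp, ← Functor.map_comp, TopPair.Hom.w f])

/-- The relative singular homology group `H_l(X, A)` with integer coefficients. -/
def relHomology (l : ℕ) (P : TopPair.{0}) : ModuleCat.{0} ℤ :=
  (relChains P).homology l

/-- The homomorphism `H_l(X, A) ⟶ H_l(Y, B)` induced by a map of pairs. -/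
def relHomologyMap (l : ℕ) {P Q : TopPair.{0}} (f : P ⟶ Q) : relHomology l P ⟶ relHomology l Q :=
  HomologicalComplex.homologyMap (relChainsMap f) l

/-! ### Pairs of subsets of a space -/

section Pairs

variable {E : Type} [TopologicalSpace E]

/-- The pair `(X, A)` formed by two subsets `A ⊆ X` of `E`. -/
def subsetPair {X A : Set E} (h : A ⊆ X) : TopPair.{0} :=
  TopPair.of (A := TopCat.of A) (X := TopCat.of X)
    (TopCat.ofHom ⟨Set.inclusion h, continuous_inclusion h⟩) (Topology.IsEmbedding.inclusion h)

/-- The inclusion of pairs `(X, A) ⟶ (Y, B)` for `X ⊆ Y` and `A ⊆ B`. -/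
def subsetPairIncl {X A Y B : Set E} (h : A ⊆ X) (h' : B ⊆ Y) (hX : X ⊆ Y) (hA : A ⊆ B) :
    subsetPair h ⟶ subsetPair h' :=
  TopPair.ofHom (X := subsetPair h) (Y := subsetPair h')
    (TopCat.ofHom ⟨Set.inclusion hX, continuous_inclusion hX⟩)
    (TopCat.ofHom ⟨Set.inclusion hA, continuous_inclusion hA⟩) rfl

end Pairs

/-! ### Submanifolds and reach -/

section Submanifolds

variable {E : Type*} [NormedAddCommGroup E] [NormedSpace ℝ E]

/-- `M` is a (`C^∞`, embedded, boundaryless) submanifold of `E`: around each point of `M` some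
diffeomorphism `Φ` between open subsets of `E` straightens `M` to a linear subspace `W`. -/
def IsSmoothSubmanifold (M : Set E) : Prop :=
  ∀ p ∈ M, ∃ (Φ : OpenPartialHomeomorph E E) (W : Submodule ℝ E),
    p ∈ Φ.source ∧ ContDiffOn ℝ ∞ Φ Φ.source ∧ ContDiffOn ℝ ∞ Φ.symm Φ.target ∧
      ∀ y ∈ Φ.source, y ∈ M ↔ Φ y ∈ W

/-- A smooth map `f` restricts to a smooth embedding of the submanifold `S`: it is a topological
embedding of `S` and its differential is injective on every tangent space of `S`. (For a
submanifold `S` the set `tangentConeAt ℝ S p` is the tangent space of `S` at `p`.) -/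
def IsEmbeddedBy {F : Type*} [NormedAddCommGroup F] [NormedSpace ℝ F] (f : E → F) (S : Set E) :
    Prop :=
  Topology.IsEmbedding (S.domRestrict f) ∧
    ∀ p ∈ S, Set.InjOn (fderiv ℝ f p) (tangentConeAt ℝ S p)

end Submanifolds

section Reach

variable {E : Type*} [NormedAddCommGroup E] [InnerProductSpace ℝ E]

/-- The (open) normal bundle of `M` of radius `r`: the pairs `(p, v)` with `p ∈ M` and `v` a vector
of length less than `r` orthogonal to the tangent space of `M` at `p`. -/
def normalBundle (M : Set E) (r : ℝ) : Set (E × E) :=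
  {q | q.1 ∈ M ∧ (∀ w ∈ tangentConeAt ℝ M q.1, inner ℝ w q.2 = 0) ∧ ‖q.2‖ < r}

/-- The reach of `M`: the supremum, in the extended reals, of the radii `r > 0` for which the normal
bundle of radius `r` is embedded in `E` by the map `(p, v) ↦ p + v`. -/
def reach (M : Set E) : EReal :=
  sSup {s : EReal | ∃ r : ℝ, 0 < r ∧ IsEmbeddedBy (fun q : E × E => q.1 + q.2) (normalBundle M r) ∧
    s = (r : EReal)}

end Reach

/-! ### The pairs that occur in the statement -/

section LocalPairs

variable {E : Type} [PseudoMetricSpace E]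

/-- The pair `(K, K - B_ρ(x))`, where `B_ρ(x)` is the open ball. -/
def pairBall (K : Set E) (x : E) (ρ : ℝ) : TopPair.{0} :=
  subsetPair (Set.sdiff_subset : K \ Metric.ball x ρ ⊆ K)

/-- The pair `(K, K - {x})`. -/
def pairPoint (K : Set E) (x : E) : TopPair.{0} :=
  subsetPair (Set.sdiff_subset : K \ {x} ⊆ K)

/-- The inclusion `(M, M - B_ρ(x)) ⟶ (K, K - B_ρ(x))` for `M ⊆ K`. -/
def pairBallIncl (M K : Set E) (h : M ⊆ K) (x : E) (ρ : ℝ) :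
    pairBall M x ρ ⟶ pairBall K x ρ :=
  subsetPairIncl _ _ h (Set.sdiff_subset_sdiff_left h)

/-- The inclusion `(M, M - B_ρ(x)) ⟶ (M, M - {x})` for `ρ > 0`. -/
def pairBallToPoint (M : Set E) (x : E) {ρ : ℝ} (hρ : 0 < ρ) : pairBall M x ρ ⟶ pairPoint M x :=
  subsetPairIncl _ _ subset_rfl
    (Set.sdiff_subset_sdiff_right (Set.singleton_subset_iff.2 (Metric.mem_ball_self hρ)))

end LocalPairs

end ReachHom

end

/-! Choose r > max(α, ρ/2) strictly below a radius whose normal bundle is embedded; only injectivity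
of (p, v) ↦ p + v is used. If q ∈ M is nearest to z ≠ q, then z - q is normal, and injectivity
forces q to be nearest also to both points at distance r from q on the line through q and z. So the
two open balls of radius r tangent to M at q miss M: this is the two-sided Federer inequality
`HasFedererBound`.

It makes the nearest-point projection locally Lipschitz at distances below r, so `clip`, the
retraction onto D_β, is continuous there. It also says that the distance to x has no critical values
on D_β in (β, 2r): pushing y away from x and clipping back to D_β strictly increases the distance
(`HasFedererBound.lt_dist_clip_push`). By compactness the gain is uniform, so the radius of the
removed ball can vary in this range without changing homology.

Clipping D_β to a thinner neighbourhood can move points into the removed ball, but only slightly;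
the freedom in the radius absorbs this by a two-out-of-six argument (`homologyIncl_of_deformation`).
This compares M - B_ρ with D_α - B_ρ. In M itself (β = 0) the radius shrinks from ρ to a small s,
and a chart estimate on chords and normals handles the passage from s to the point x. The five lemma
then gives the statement for pairs. -/

noncomputable section

namespace ReachHom

/-! ### Inclusions that induce isomorphisms on singular homology -/

section Inclusions

variable {E : Type} [TopologicalSpace E]

/-- The inclusion `A ⟶ B` of subsets of a topological space. -/
def inclTop {A B : Set E} (h : A ⊆ B) : TopCat.of A ⟶ TopCat.of B :=
  TopCat.ofHom ⟨Set.inclusion h, continuous_inclusion h⟩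

/-- `A ⊆ B`, and the inclusion induces an isomorphism on singular homology. -/
def HomologyIncl (A B : Set E) : Prop :=
  ∃ h : A ⊆ B, QuasiIso (singularChains.map (inclTop h))

lemma inclTop_comp {A B C : Set E} (h : A ⊆ B) (h' : B ⊆ C) :
    inclTop h ≫ inclTop h' = inclTop (h.trans h') := rfl

lemma HomologyIncl.refl (A : Set E) : HomologyIncl A A := by
  refine ⟨subset_rfl, ?_⟩
  have : inclTop (subset_refl A) = 𝟙 _ := rfl
  rw [this, CategoryTheory.Functor.map_id]
  infer_instance

lemma HomologyIncl.trans {A B C : Set E} (h : HomologyIncl A B) (h' : HomologyIncl B C) :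
    HomologyIncl A C := by
  obtain ⟨i, hi⟩ := h
  obtain ⟨j, hj⟩ := h'
  refine ⟨i.trans j, ?_⟩
  rw [← inclTop_comp i j, Functor.map_comp]
  infer_instance

/-- The two-out-of-six property of isomorphisms, for the first of three morphisms. -/
lemma isIso_of_isIso_comp_comp {C : Type*} [Category C] {X Y Z W : C} (f : X ⟶ Y) (g : Y ⟶ Z)
    (h : Z ⟶ W) (h₁ : IsIso (f ≫ g)) (h₂ : IsIso (g ≫ h)) : IsIso f := by
  have : IsSplitEpi g := IsSplitEpi.mk' ⟨inv (f ≫ g) ≫ f, by simp⟩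
  have : Mono g := mono_of_mono g h
  have : IsIso g := isIso_of_mono_of_isSplitEpi g
  exact IsIso.of_isIso_comp_right f g

/-- If the identity of `B` deforms inside `B'` to a map into `A'`, and this deformation keeps `A`
inside `A'`, then `A ⊆ B` is a homology isomorphism as soon as `A ⊆ A'` and `B ⊆ B'` are. -/
lemma homologyIncl_of_deformation {A B A' B' : Set E} (hAB : A ⊆ B) (hAB' : A' ⊆ B')
    (hA : HomologyIncl A A') (hB : HomologyIncl B B') (H : ℝ × E → E)
    (hH : ContinuousOn H (Set.Icc 0 1 ×ˢ B))
    (h0 : ∀ y ∈ B, H (0, y) = y) (h1 : ∀ y ∈ B, H (1, y) ∈ A')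
    (hHB : ∀ t ∈ Set.Icc (0 : ℝ) 1, ∀ y ∈ B, H (t, y) ∈ B')
    (hHA : ∀ t ∈ Set.Icc (0 : ℝ) 1, ∀ y ∈ A, H (t, y) ∈ A') :
    HomologyIncl A B := by
  obtain ⟨i, hi⟩ := hA
  obtain ⟨j, hj⟩ := hB
  refine ⟨hAB, ?_⟩
  have key : Continuous fun q : unitInterval × B => H (q.1, q.2) :=
    hH.comp_continuous (f := fun q : unitInterval × B => ((q.1 : ℝ), (q.2 : E)))
      (by fun_prop) fun q => ⟨q.1.2, q.2.2⟩
  let k : TopCat.of B ⟶ TopCat.of A' := TopCat.ofHom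
    ⟨fun y => ⟨H (1, y), h1 y y.2⟩, Continuous.subtype_mk
      (key.comp (by fun_prop : Continuous fun y : B => ((1 : unitInterval), y))) _⟩
  let HB : TopCat.Homotopy (inclTop j) (k ≫ inclTop hAB') :=
    { toFun := fun q => ⟨H (q.1, q.2), hHB q.1 q.1.2 q.2 q.2.2⟩
      continuous_toFun := key.subtype_mk _
      map_zero_left := fun y => Subtype.ext (h0 y y.2)
      map_one_left := fun y => rfl }
  have keyA : Continuous fun q : unitInterval × A => H (q.1, q.2) :=
    key.comp (f := fun q : unitInterval × A => (q.1, Set.inclusion hAB q.2)) (by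
      have := continuous_inclusion hAB
      fun_prop)
  let HA : TopCat.Homotopy (inclTop i) (inclTop hAB ≫ k) :=
    { toFun := fun q => ⟨H (q.1, q.2), hHA q.1 q.1.2 q.2 q.2.2⟩
      continuous_toFun := keyA.subtype_mk _
      map_zero_left := fun y => Subtype.ext (h0 y (hAB y.2))
      map_one_left := fun y => rfl }
  rw [quasiIso_iff]
  intro l
  rw [quasiIsoAt_iff_isIso_homologyMap]
  -- Two-out-of-six for A → B → A' → B', the middle map being the end of the deformation: each
  -- composite of consecutive maps is homotopic to an inclusion known to be an isomorphism on
  -- homology.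
  refine isIso_of_isIso_comp_comp _
    (HomologicalComplex.homologyMap (singularChains.map k) l)
    (HomologicalComplex.homologyMap (singularChains.map (inclTop hAB')) l) ?_ ?_
  · rw [← HomologicalComplex.homologyMap_comp, ← Functor.map_comp,
      ← HA.congr_homologyMap_singularChainComplexFunctor]
    infer_instance
  · rw [← HomologicalComplex.homologyMap_comp, ← Functor.map_comp,
      ← HB.congr_homologyMap_singularChainComplexFunctor]
    infer_instance

/-- A map of pairs is an isomorphism on relative homology if it is one on the homology of both
terms. -/
lemma isIso_relHomologyMap_subsetPairIncl {X A Y B : Set E} (h : A ⊆ X) (h' : B ⊆ Y)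
    (hX : HomologyIncl X Y) (hA : HomologyIncl A B) (l : ℕ) :
    IsIso (relHomologyMap l (subsetPairIncl h h' hX.1 hA.1)) := by
  have mono (P : TopPair.{0}) : Mono (singularChains.map P.map) := by
    have : Mono P.map := (TopCat.mono_iff_injective _).2 P.isEmbedding_map.injective
    infer_instance
  let S (P : TopPair.{0}) : ShortComplex (ChainComplex (ModuleCat.{0} ℤ) ℕ) :=
    ShortComplex.mk (singularChains.map P.map) (cokernel.π _) (cokernel.condition _)
  have hS (P : TopPair.{0}) : (S P).ShortExact :=
    { exact := ShortComplex.exact_cokernel _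
      mono_f := mono P
      epi_g := inferInstanceAs (Epi (cokernel.π _)) }
  let f := subsetPairIncl h h' hX.1 hA.1
  let φ : S (subsetPair h) ⟶ S (subsetPair h') :=
    { τ₁ := singularChains.map (TopPair.Hom.snd f)
      τ₂ := singularChains.map (TopPair.Hom.fst f)
      τ₃ := relChainsMap f
      comm₁₂ := by
        change singularChains.map _ ≫ singularChains.map _ = singularChains.map _ ≫ singularChains.map _
        rw [← Functor.map_comp, ← Functor.map_comp, TopPair.Hom.w f]
      comm₂₃ := (cokernel.π_desc _ _ _).symm }
  -- Five lemma for the long exact sequences of the two pairs.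
  have : QuasiIso φ.τ₃ :=
    HomologicalComplex.HomologySequence.quasiIso_τ₃ φ (hS _) (hS _) hA.2 hX.2
  exact inferInstanceAs (IsIso (HomologicalComplex.homologyMap φ.τ₃ l))

end Inclusions

/-! ### Nearest points and Federer's inequality -/

lemma clip_coeff_mem {β : ℝ} (hβ : 0 ≤ β) (d : ℝ) : 0 ≤ β / max β d ∧ β / max β d ≤ 1 :=
  ⟨div_nonneg hβ (hβ.trans (le_max_left _ _)),
    div_le_one_of_le₀ (le_max_left _ _) (hβ.trans (le_max_left _ _))⟩

section NearestPoint

variable {E : Type*} [NormedAddCommGroup E]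

open Classical in
/-- A nearest point of `M` to `z`, where there is one. -/
def nearest (M : Set E) (z : E) : E :=
  if h : ∃ q ∈ M, dist z q = Metric.infDist z M then h.choose else z

section Proper

variable [ProperSpace E] {M : Set E}

lemma nearest_mem (hc : IsClosed M) (hne : M.Nonempty) (z : E) : nearest M z ∈ M := by
  have h : ∃ q ∈ M, dist z q = Metric.infDist z M :=
    (hc.exists_infDist_eq_dist hne z).imp fun q hq => ⟨hq.1, hq.2.symm⟩
  rw [nearest, dif_pos h]
  exact h.choose_spec.1

lemma dist_nearest (hc : IsClosed M) (hne : M.Nonempty) (z : E) :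
    dist z (nearest M z) = Metric.infDist z M := by
  have h : ∃ q ∈ M, dist z q = Metric.infDist z M :=
    (hc.exists_infDist_eq_dist hne z).imp fun q hq => ⟨hq.1, hq.2.symm⟩
  rw [nearest, dif_pos h]
  exact h.choose_spec.2

lemma norm_sub_nearest (hc : IsClosed M) (hne : M.Nonempty) (z : E) :
    ‖z - nearest M z‖ = Metric.infDist z M := by
  rw [← dist_eq_norm, dist_nearest hc hne]

lemma nearest_of_infDist_eq_zero (hc : IsClosed M) (hne : M.Nonempty) {z : E}
    (hz : Metric.infDist z M = 0) : nearest M z = z := by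
  have := dist_nearest hc hne z
  rw [hz] at this
  exact (dist_eq_zero.1 this).symm

end Proper

variable [InnerProductSpace ℝ E]

/-- Two-sided form of Federer's inequality for sets of reach at least `r`. -/
def HasFedererBound (M : Set E) (r : ℝ) : Prop :=
  ∀ z, ∀ q ∈ M, ∀ m ∈ M, dist z q = Metric.infDist z M → Metric.infDist z M < r →
    2 * r * |inner ℝ (m - q) (z - q)| ≤ ‖m - q‖ ^ 2 * ‖z - q‖

/-- `z` if its distance to `M` is at most `β`, otherwise the point at distance `β` from the nearest
point of `M` on the segment that joins it to `z`. -/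
def clip (M : Set E) (β : ℝ) (z : E) : E :=
  nearest M z + (β / max β (Metric.infDist z M)) • (z - nearest M z)

lemma infDist_push_le {M : Set E} {β : ℝ} {x y : E} {t : ℝ} (ht : 0 ≤ t) (hy : Metric.infDist y M ≤ β) :
    Metric.infDist (y + t • (y - x)) M ≤ β + t * dist y x := by
  refine Metric.infDist_le_infDist_add_dist.trans (add_le_add hy ?_)
  rw [dist_eq_norm, add_sub_cancel_left, norm_smul, Real.norm_of_nonneg ht, dist_eq_norm]

lemma dist_push {x y : E} {t : ℝ} (ht : 0 ≤ t) :
    dist (y + t • (y - x)) x = (1 + t) * dist y x := by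
  have : y + t • (y - x) - x = (1 + t) • (y - x) := by module
  rw [dist_eq_norm, this, norm_smul, Real.norm_of_nonneg (by linarith), dist_eq_norm]

variable [ProperSpace E] {M : Set E} {r : ℝ}

/-- Adding Federer's inequality at p against q and at q against p gives r(‖p - q‖² - ⟨p - q, z - w⟩)
≤ s‖p - q‖²; Cauchy–Schwarz and division by ‖p - q‖ finish. -/
lemma HasFedererBound.dist_nearest_le (h : HasFedererBound M r) (hc : IsClosed M)
    (hne : M.Nonempty) {s : ℝ} (hs : s < r) {z w : E} (hz : Metric.infDist z M ≤ s)
    (hw : Metric.infDist w M ≤ s) :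
    dist (nearest M z) (nearest M w) ≤ r / (r - s) * dist z w := by
  set p := nearest M z with hp
  set q := nearest M w with hq
  have hs0 : 0 ≤ s := Metric.infDist_nonneg.trans hz
  have h1 := h z p (nearest_mem hc hne z) q (nearest_mem hc hne w) (dist_nearest hc hne z)
    (hz.trans_lt hs)
  have h2 := h w q (nearest_mem hc hne w) p (nearest_mem hc hne z) (dist_nearest hc hne w)
    (hw.trans_lt hs)
  rw [norm_sub_nearest hc hne] at h1 h2
  have e : inner ℝ (q - p) (z - p) + inner ℝ (p - q) (w - q) =
      ‖p - q‖ ^ 2 - inner ℝ (p - q) (z - w) := by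
    rw [← real_inner_self_eq_norm_sq]
    simp only [inner_sub_left, inner_sub_right]
    rw [real_inner_comm p q]
    ring
  have h3 := (abs_le.1 (le_refl |inner ℝ (q - p) (z - p)|)).2
  have h4 := (abs_le.1 (le_refl |inner ℝ (p - q) (w - q)|)).2
  have h5 := real_inner_le_norm (p - q) (z - w)
  rw [norm_sub_rev q p] at h1
  rw [dist_eq_norm, dist_eq_norm, div_mul_eq_mul_div, le_div_iff₀ (by linarith)]
  rcases (norm_nonneg (p - q)).eq_or_lt with h0 | h0
  · rw [← h0]
    have := norm_nonneg (z - w)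
    simpa using mul_nonneg (by linarith) this
  · have h6 : ‖p - q‖ ^ 2 * Metric.infDist z M ≤ ‖p - q‖ ^ 2 * s := by gcongr
    have h7 : ‖p - q‖ ^ 2 * Metric.infDist w M ≤ ‖p - q‖ ^ 2 * s := by gcongr
    have h8 : r * (‖p - q‖ ^ 2 - ‖p - q‖ * ‖z - w‖) ≤ ‖p - q‖ ^ 2 * s := by
      have : r * (‖p - q‖ ^ 2 - ‖p - q‖ * ‖z - w‖) ≤
          r * (inner ℝ (q - p) (z - p) + inner ℝ (p - q) (w - q)) := by
        apply mul_le_mul_of_nonneg_left _ (by linarith)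
        linarith
      have h9 := mul_le_mul_of_nonneg_left h3 (by linarith : (0 : ℝ) ≤ r)
      have h10 := mul_le_mul_of_nonneg_left h4 (by linarith : (0 : ℝ) ≤ r)
      linarith
    refine le_of_mul_le_mul_left ?_ h0
    linarith

lemma HasFedererBound.continuousOn_nearest (h : HasFedererBound M r) (hc : IsClosed M)
    (hne : M.Nonempty) : ContinuousOn (nearest M) {z | Metric.infDist z M < r} := by
  intro z hz
  rw [Set.mem_ofPred_eq] at hz
  obtain ⟨s, hs1, hs2⟩ := exists_between hz
  have hL : LipschitzOnWith (Real.toNNReal (r / (r - s))) (nearest M)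
      {z | Metric.infDist z M < s} := by
    refine LipschitzOnWith.of_dist_le_mul fun a ha b hb => ?_
    have hs0 : 0 ≤ s := Metric.infDist_nonneg.trans hs1.le
    rw [Real.coe_toNNReal _ (div_nonneg (by linarith) (by linarith))]
    exact h.dist_nearest_le hc hne hs2 (le_of_lt ha) (le_of_lt hb)
  have : {z | Metric.infDist z M < s} ∈ 𝓝 z :=
    (isOpen_lt (Metric.continuous_infDist_pt M) continuous_const).mem_nhds hs1
  exact (hL.continuousOn.continuousAt this).continuousWithinAt

variable {β : ℝ}

lemma HasFedererBound.continuousOn_clip (h : HasFedererBound M r) (hc : IsClosed M)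
    (hne : M.Nonempty) (hβ : 0 ≤ β) : ContinuousOn (clip M β) {z | Metric.infDist z M < r} := by
  have hn := h.continuousOn_nearest hc hne
  have hd : Continuous fun z => β / max β (Metric.infDist z M) := by
    rcases hβ.eq_or_lt with rfl | hβ
    · simp only [zero_div]
      exact continuous_const
    · exact continuous_const.div (continuous_const.max (Metric.continuous_infDist_pt M))
        fun z => (hβ.trans_le (le_max_left _ _)).ne'
  exact hn.add (hd.continuousOn.smul (continuousOn_id.sub hn))

lemma clip_of_le (hc : IsClosed M) (hne : M.Nonempty) {z : E}
    (hz : Metric.infDist z M ≤ β) : clip M β z = z := by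
  -- For β = 0 the coefficient in `clip` is 0 / 0 = 0, so `clip` returns the nearest point, here z
  -- itself.
  rcases (Metric.infDist_nonneg.trans hz : 0 ≤ β).eq_or_lt with rfl | h0
  · rw [clip, nearest_of_infDist_eq_zero hc hne (le_antisymm hz Metric.infDist_nonneg)]
    simp
  · rw [clip, max_eq_left hz, div_self h0.ne', one_smul, add_sub_cancel]

lemma infDist_clip_le (hc : IsClosed M) (hne : M.Nonempty) (hβ : 0 ≤ β) (z : E) :
    Metric.infDist (clip M β z) M ≤ β := by
  refine (Metric.infDist_le_dist_of_mem (nearest_mem hc hne z)).trans ?_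
  rw [dist_eq_norm, clip, add_sub_cancel_left, norm_smul, norm_sub_nearest hc hne,
    Real.norm_of_nonneg (clip_coeff_mem hβ _).1, div_mul_eq_mul_div]
  refine div_le_of_le_mul₀ (hβ.trans (le_max_left _ _)) hβ ?_
  exact mul_le_mul_of_nonneg_left (le_max_right _ _) hβ

lemma dist_clip_of_le (hc : IsClosed M) (hne : M.Nonempty) (hβ : 0 ≤ β) {z : E}
    (hz : β ≤ Metric.infDist z M) : dist z (clip M β z) = Metric.infDist z M - β := by
  rcases (hβ.trans hz).eq_or_lt with h0 | h0
  · rw [clip_of_le hc hne (h0 ▸ hβ), dist_self]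
    linarith
  · have : z - clip M β z = (1 - β / max β (Metric.infDist z M)) • (z - nearest M z) := by
      rw [clip]
      module
    rw [dist_eq_norm, this, norm_smul, norm_sub_nearest hc hne,
      Real.norm_of_nonneg (sub_nonneg.2 (clip_coeff_mem hβ _).2), max_eq_right hz]
    field_simp

lemma dist_clip_le (hc : IsClosed M) (hne : M.Nonempty) (hβ : 0 ≤ β) {z : E} {d : ℝ} (hd : 0 ≤ d)
    (hz : Metric.infDist z M ≤ β + d) : dist z (clip M β z) ≤ d := by
  rcases le_total (Metric.infDist z M) β with h | h
  · rwa [clip_of_le hc hne h, dist_self]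
  · rw [dist_clip_of_le hc hne hβ h]
    linarith

lemma infDist_segment_clip_le (hc : IsClosed M) (hne : M.Nonempty) (hβ : 0 ≤ β) (z : E) {t : ℝ}
    (ht : t ∈ Set.Icc (0 : ℝ) 1) :
    Metric.infDist (z + t • (clip M β z - z)) M ≤ Metric.infDist z M := by
  refine (Metric.infDist_le_dist_of_mem (nearest_mem hc hne z)).trans ?_
  have hk := clip_coeff_mem hβ (Metric.infDist z M)
  set k := β / max β (Metric.infDist z M)
  have : z + t • (clip M β z - z) - nearest M z = (1 - t * (1 - k)) • (z - nearest M z) := by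
    rw [clip]
    module
  rw [dist_eq_norm, this, norm_smul, norm_sub_nearest hc hne]
  refine mul_le_of_le_one_left Metric.infDist_nonneg ?_
  rw [Real.norm_eq_abs, abs_le]
  have h1 : 0 ≤ t * (1 - k) := mul_nonneg ht.1 (by linarith)
  have h2 : t * (1 - k) ≤ 1 := mul_le_one₀ ht.2 (by linarith) (by linarith)
  constructor <;> linarith

/-- Pushing away from `x` and clipping does not decrease the distance to `x`. -/
lemma le_dist_clip_push (hc : IsClosed M) (hne : M.Nonempty) (hβ : 0 ≤ β) {x y : E} {t : ℝ}
    (ht : 0 ≤ t) (hy : Metric.infDist y M ≤ β) :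
    dist y x ≤ dist (clip M β (y + t • (y - x))) x := by
  -- Clipping moves the point back by at most t · dist y x, exactly the length of the push.
  have h1 := dist_clip_le hc hne hβ (mul_nonneg ht dist_nonneg) (infDist_push_le (x := x) ht hy)
  have h2 := dist_triangle (y + t • (y - x)) (clip M β (y + t • (y - x))) x
  rw [dist_push ht] at h2
  linarith

/-- Pushing away from `x` and clipping increases the distance to `x` in the noncritical range. -/
lemma HasFedererBound.lt_dist_clip_push (h : HasFedererBound M r) (hc : IsClosed M)
    (hβ : 0 ≤ β) {x y : E} (hx : x ∈ M) {t : ℝ} (ht : 0 < t)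
    (hy : Metric.infDist y M ≤ β) (h1 : β < dist y x) (h2 : dist y x < 2 * r)
    (hz : Metric.infDist (y + t • (y - x)) M < r) :
    dist y x < dist (clip M β (y + t • (y - x))) x := by
  have hne : M.Nonempty := ⟨x, hx⟩
  set z := y + t • (y - x) with hzdef
  set a := dist y x
  have hzx : dist z x = (1 + t) * a := dist_push ht.le
  have ha : 0 < a := hβ.trans_lt h1
  rcases le_or_gt (Metric.infDist z M) β with hle | hlt
  · rw [clip_of_le hc hne hle, hzx]
    nlinarith
  by_contra! hcon
  set q := nearest M z with hq
  set b := Metric.infDist z M with hb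
  have hb0 : 0 < b := hβ.trans_lt hlt
  have hvb : ‖z - q‖ = b := norm_sub_nearest hc hne z
  have hF := h z q (nearest_mem hc hne z) x hx (dist_nearest hc hne z) hz
  set u := clip M β z - x with hu
  set v := z - q with hv
  rw [dist_eq_norm] at hcon
  have hclip : clip M β z = q + (β / b) • v := by rw [clip, max_eq_right hlt.le]
  have e1 : z - x = u + ((b - β) / b) • v := by
    rw [hu, hclip, hv, sub_div, div_self hb0.ne']
    module
  have e2 : x - q = (β / b) • v - u := by
    rw [hu, hclip]
    module
  -- c is the component of u along the unit normal v / b. If ‖u‖ ≤ a, then the length of z - x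
  -- together with b - β ≤ ta forces c ≥ a. Federer's inequality at q against x then gives 2r(a - β)
  -- ≤ (a - β)², impossible for β < a < 2r.
  set c := inner ℝ u v / b with hcdef
  have hcb : inner ℝ u v = c * b := by rw [hcdef]; field_simp
  have n1 : ((1 + t) * a) ^ 2 = ‖u‖ ^ 2 + 2 * (b - β) * c + (b - β) ^ 2 := by
    rw [← hzx, dist_eq_norm, e1, norm_add_sq_real, inner_smul_right, norm_smul, hcb, hvb, mul_pow,
      Real.norm_eq_abs, sq_abs]
    field_simp
  have n2 : ‖x - q‖ ^ 2 = β ^ 2 - 2 * β * c + ‖u‖ ^ 2 := by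
    rw [e2, norm_sub_sq_real, inner_smul_left, norm_smul, real_inner_comm, hcb, hvb, mul_pow,
      Real.norm_eq_abs, sq_abs]
    simp only [conj_trivial]
    field_simp
  have n3 : inner ℝ (x - q) v = (β - c) * b := by
    rw [e2, inner_sub_left, inner_smul_left, hcb, real_inner_self_eq_norm_sq, hvb]
    simp only [conj_trivial]
    field_simp
  rw [n2, n3, hvb, abs_mul, abs_of_pos hb0, ← mul_assoc] at hF
  have hF' := le_of_mul_le_mul_right hF hb0
  have hu2 : ‖u‖ ^ 2 ≤ a ^ 2 := by gcongr
  have hbt : b ≤ β + t * a := infDist_push_le ht.le hy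
  have he : (b - β) ^ 2 ≤ (t * a) ^ 2 := by
    have : 0 ≤ b - β := by linarith
    gcongr
    linarith
  have k1 : t * a * a ≤ (b - β) * c := by nlinarith
  have hc0 : 0 < c := by
    by_contra! hneg
    have : (b - β) * c ≤ 0 := mul_nonpos_of_nonneg_of_nonpos (by linarith) hneg
    have : 0 < t * a * a := by positivity
    linarith
  have k2 : (b - β) * c ≤ t * a * c := mul_le_mul_of_nonneg_right (by linarith) hc0.le
  have hac : a ≤ c := le_of_mul_le_mul_left (k1.trans k2) (by positivity)
  have hr : 0 < r := hb0.trans hz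
  have k3 : 2 * r * (c - β) ≤ 2 * r * |β - c| := by
    gcongr
    rw [abs_sub_comm]
    exact le_abs_self _
  have k4 : 2 * r * (a - β) ≤ 2 * r * (c - β) := by gcongr
  have k5 : 2 * β * a ≤ 2 * β * c := by gcongr
  have k6 : 0 < (a - β) * (2 * r + β - a) := mul_pos (by linarith) (by linarith)
  nlinarith

end NearestPoint

/-! ### Complements of balls in closed neighbourhoods -/

section Neighbourhoods

variable {E : Type} [NormedAddCommGroup E] {M : Set E} {r β : ℝ}

/-- The closed `β`-neighbourhood of `M`, minus the open ball of radius `σ` about `x`. -/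
def thickeningSdiffBall (M : Set E) (x : E) (β σ : ℝ) : Set E :=
  {y | Metric.infDist y M ≤ β ∧ σ ≤ dist y x}

lemma thickeningSdiffBall_mono {x : E} {β β' σ σ' : ℝ} (hβ : β ≤ β') (hσ : σ' ≤ σ) :
    thickeningSdiffBall M x β σ ⊆ thickeningSdiffBall M x β' σ' :=
  fun _ hy => ⟨hy.1.trans hβ, hσ.trans hy.2⟩

lemma thickeningSdiffBall_zero (hc : IsClosed M) (hne : M.Nonempty) (x : E) (σ : ℝ) :
    thickeningSdiffBall M x 0 σ = M \ Metric.ball x σ := by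
  ext y
  rw [thickeningSdiffBall, Set.mem_ofPred_eq, Set.mem_sdiff, Metric.mem_ball, not_lt,
    hc.mem_iff_infDist_zero hne]
  exact and_congr_left fun _ => ⟨fun h => le_antisymm h Metric.infDist_nonneg, fun h => h.le⟩

lemma thickeningSdiffBall_eq (hne : M.Nonempty) (hβ : 0 ≤ β) (x : E) (σ : ℝ) :
    thickeningSdiffBall M x β σ = Metric.cthickening β M \ Metric.ball x σ := by
  ext y
  rw [thickeningSdiffBall, Set.mem_ofPred_eq, Set.mem_sdiff, Metric.mem_ball, not_lt,
    Metric.mem_cthickening_iff, Metric.infDist,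
    ENNReal.le_ofReal_iff_toReal_le (Metric.infEDist_ne_top hne) hβ]

variable [InnerProductSpace ℝ E] [ProperSpace E]

/-- For a uniform `c > 0`, the radius of the removed ball may be changed by `c`. -/
lemma HasFedererBound.exists_homologyIncl_step (h : HasFedererBound M r) (hc : IsClosed M)
    (hβ : 0 ≤ β) (hβr : β < r) {x : E} (hx : x ∈ M) {s₁ s₂ : ℝ} (h1 : β < s₁) (h2 : s₂ < 2 * r) :
    ∃ c > 0, ∀ a b, s₁ ≤ a → a ≤ b → b ≤ s₂ → b ≤ a + c →
      HomologyIncl (thickeningSdiffBall M x β b) (thickeningSdiffBall M x β a) := by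
  have hne : M.Nonempty := ⟨x, hx⟩
  rcases lt_or_ge s₂ s₁ with h12 | h12
  · exact ⟨1, one_pos, fun a b _ _ _ _ => by linarith⟩
  -- The push is cut off at distance S from x, so it is positive on the shell up to s₂ and bounded
  -- everywhere; τ makes its length at most (r - β)/2, which keeps pushed points within distance r
  -- of M.
  set S := s₂ + 1 with hS
  have hS0 : 0 < S := by linarith
  set τ := (r - β) / (2 * S ^ 2) with hτ
  have hτ0 : 0 < τ := div_pos (by linarith) (by positivity)
  let T : ℝ × E → ℝ := fun q => q.1 * (τ * max 0 (S - dist q.2 x))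
  let H : ℝ × E → E := fun q => clip M β (q.2 + T q • (q.2 - x))
  have hT : ∀ t ∈ Set.Icc (0 : ℝ) 1, ∀ y, 0 ≤ T (t, y) := fun t ht y =>
    mul_nonneg ht.1 (mul_nonneg hτ0.le (le_max_left _ _))
  have hreach : ∀ t ∈ Set.Icc (0 : ℝ) 1, ∀ y, Metric.infDist y M ≤ β →
      Metric.infDist (y + T (t, y) • (y - x)) M < r := by
    intro t ht y hy
    refine (infDist_push_le (hT t ht y) hy).trans_lt ?_
    have hd : 0 ≤ dist y x := dist_nonneg
    have e1 : max 0 (S - dist y x) * dist y x ≤ S ^ 2 := by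
      rcases le_total S (dist y x) with h' | h'
      · rw [max_eq_left (by linarith), zero_mul]
        positivity
      · rw [max_eq_right (by linarith)]
        nlinarith
    have e2 : T (t, y) * dist y x ≤ τ * S ^ 2 := by
      have : T (t, y) * dist y x = t * (τ * (max 0 (S - dist y x) * dist y x)) := by
        simp only [T]
        ring
      rw [this]
      have e3 : τ * (max 0 (S - dist y x) * dist y x) ≤ τ * S ^ 2 := by gcongr
      exact (mul_le_of_le_one_left (mul_nonneg hτ0.le
        (mul_nonneg (le_max_left _ _) hd)) ht.2).trans e3
    have e4 : τ * S ^ 2 = (r - β) / 2 := by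
      rw [hτ]
      field_simp
    linarith
  have hHcont : ContinuousOn H (Set.Icc 0 1 ×ˢ {y | Metric.infDist y M ≤ β}) :=
    (h.continuousOn_clip hc hne hβ).comp (by fun_prop) fun q hq => hreach q.1 hq.1 q.2 hq.2
  have hmono : ∀ t ∈ Set.Icc (0 : ℝ) 1, ∀ y, Metric.infDist y M ≤ β →
      dist y x ≤ dist (H (t, y)) x := fun t ht y hy =>
    le_dist_clip_push hc hne hβ (hT t ht y) hy
  have hone : (1 : ℝ) ∈ Set.Icc (0 : ℝ) 1 := Set.right_mem_Icc.2 zero_le_one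
  set K := {y | Metric.infDist y M ≤ β} ∩
    ({y | s₁ ≤ dist y x} ∩ {y | dist y x ≤ s₂}) with hK
  have hKc : IsCompact K := by
    refine Metric.isCompact_of_isClosed_isBounded (IsClosed.inter
      (isClosed_le (Metric.continuous_infDist_pt M) continuous_const)
      ((isClosed_le (by fun_prop) (by fun_prop)).inter
        (isClosed_le (by fun_prop) (by fun_prop)))) ?_
    exact Metric.isBounded_closedBall.subset fun y hy => Metric.mem_closedBall.2 hy.2.2
  -- The gain in distance to x is positive on the compact shell K, hence bounded below by some c >
  -- 0.
  obtain ⟨c, hc0, hcK⟩ := hKc.exists_forall_le' (f := fun y => dist (H (1, y)) x - dist y x) (a := 0)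
    (by
      have : ContinuousOn (fun y => H (1, y)) K :=
        hHcont.comp (by fun_prop) fun y hy => ⟨hone, hy.1⟩
      exact ((continuous_id.dist continuous_const).comp_continuousOn this).sub (by fun_prop))
    (by
      intro y hy
      refine sub_pos.2 (h.lt_dist_clip_push hc hβ hx ?_ hy.1 (h1.trans_le hy.2.1)
        (hy.2.2.trans_lt h2) (hreach 1 hone y hy.1))
      have hy2 : dist y x ≤ s₂ := hy.2.2
      have : 0 < S - dist y x := by linarith
      exact mul_pos one_pos (mul_pos hτ0 (lt_max_of_lt_right this)))
  refine ⟨c, hc0, fun a b ha hab hb hbc => ?_⟩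
  have hstay : ∀ s, ∀ t ∈ Set.Icc (0 : ℝ) 1, ∀ y ∈ thickeningSdiffBall M x β s,
      H (t, y) ∈ thickeningSdiffBall M x β s := fun s t ht y hy =>
    ⟨infDist_clip_le hc hne hβ _, hy.2.trans (hmono t ht y hy.1)⟩
  refine homologyIncl_of_deformation (thickeningSdiffBall_mono le_rfl hab)
    (thickeningSdiffBall_mono le_rfl hab) (.refl _) (.refl _) H
    (hHcont.mono (Set.prod_mono_right fun y hy => hy.1)) ?_ ?_ (hstay a) (hstay b)
  · intro y hy
    simp only [H, T, zero_mul, zero_smul, add_zero]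
    exact clip_of_le hc hne hy.1
  · intro y hy
    refine ⟨infDist_clip_le hc hne hβ _, ?_⟩
    -- Points beyond s₂ need no gain, since the distance to x never decreases.
    rcases le_total (dist y x) s₂ with h' | h'
    · have := hcK y ⟨hy.1, ha.trans hy.2, h'⟩
      have := hy.2
      linarith
    · exact hb.trans (h'.trans (hmono 1 hone y hy.1))

/-- Finitely many steps of the uniform size c cover [s₁, s₂]. -/
lemma HasFedererBound.homologyIncl_radius (h : HasFedererBound M r) (hc : IsClosed M)
    (hβ : 0 ≤ β) (hβr : β < r) {x : E} (hx : x ∈ M) {s₁ s₂ : ℝ} (h1 : β < s₁) (h12 : s₁ ≤ s₂)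
    (h2 : s₂ < 2 * r) :
    HomologyIncl (thickeningSdiffBall M x β s₂) (thickeningSdiffBall M x β s₁) := by
  obtain ⟨c, hc0, hstep⟩ := h.exists_homologyIncl_step hc hβ hβr hx h1 h2
  have key : ∀ k : ℕ, ∀ b, s₁ ≤ b → b ≤ s₂ → b ≤ s₁ + k * c →
      HomologyIncl (thickeningSdiffBall M x β b) (thickeningSdiffBall M x β s₁) := by
    intro k
    induction k with
    | zero =>
      intro b hb _ hb'
      have : b = s₁ := le_antisymm (by simpa using hb') hb
      rw [this]
      exact .refl _
    | succ k ih =>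
      intro b hb hb2 hb'
      push_cast at hb'
      have hkc : 0 ≤ k * c := by positivity
      refine (hstep (max s₁ (b - c)) b (le_max_left _ _) (max_le hb (by linarith)) hb2 ?_).trans
        (ih _ (le_max_left _ _) (max_le h12 (by linarith)) (max_le (by linarith) (by linarith)))
      linarith [le_max_right s₁ (b - c)]
  obtain ⟨k, hk⟩ := exists_nat_ge ((s₂ - s₁) / c)
  refine key k s₂ h12 le_rfl ?_
  rw [div_le_iff₀ hc0] at hk
  linarith

/-- Retracting a closed neighbourhood of `M` to a smaller one, when this is compatible with the
removal of a ball. -/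
lemma HasFedererBound.homologyIncl_clip (h : HasFedererBound M r) (hc : IsClosed M)
    (hne : M.Nonempty) {β' d : ℝ} (hβ' : 0 ≤ β') (hd : 0 ≤ d) (hβr : β' + d < r) {x : E} {σ : ℝ}
    (h1 : HomologyIncl (thickeningSdiffBall M x β' σ) (thickeningSdiffBall M x β' (σ - d)))
    (h2 : HomologyIncl (thickeningSdiffBall M x (β' + d) σ)
      (thickeningSdiffBall M x (β' + d) (σ - d))) :
    HomologyIncl (thickeningSdiffBall M x β' σ) (thickeningSdiffBall M x (β' + d) σ) := by
  let H : ℝ × E → E := fun q => q.2 + q.1 • (clip M β' q.2 - q.2)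
  have hdist : ∀ t ∈ Set.Icc (0 : ℝ) 1, ∀ y ∈ thickeningSdiffBall M x (β' + d) σ,
      σ - d ≤ dist (H (t, y)) x := by
    intro t ht y hy
    have e1 := dist_clip_le hc hne hβ' hd hy.1
    have e2 : dist y (H (t, y)) ≤ d := by
      have : y - H (t, y) = t • (y - clip M β' y) := by
        simp only [H]
        module
      rw [dist_eq_norm, this, norm_smul, Real.norm_of_nonneg ht.1, ← dist_eq_norm]
      exact (mul_le_of_le_one_left dist_nonneg ht.2).trans e1
    have e3 := dist_triangle y (H (t, y)) x
    have := hy.2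
    linarith
  have hH1 : ∀ y, H (1, y) = clip M β' y := fun y => by simp [H]
  -- The straight-line homotopy to the clipped point moves points by at most d, so the complement of
  -- B_σ lands in that of B_{σ-d}; `h1` and `h2` compare the two radii.
  refine homologyIncl_of_deformation (thickeningSdiffBall_mono (by linarith) le_rfl)
    (thickeningSdiffBall_mono (by linarith) le_rfl) h1 h2 H ?_ ?_ ?_ ?_ ?_
  · have : ContinuousOn (fun q : ℝ × E => clip M β' q.2)
        (Set.Icc (0 : ℝ) 1 ×ˢ thickeningSdiffBall M x (β' + d) σ) :=
      (h.continuousOn_clip hc hne hβ').comp continuousOn_snd fun q hq => hq.2.1.trans_lt hβr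
    exact continuousOn_snd.add (continuousOn_fst.smul (this.sub continuousOn_snd))
  · intro y _
    simp [H]
  · intro y hy
    refine ⟨?_, hdist 1 (Set.right_mem_Icc.2 zero_le_one) y hy⟩
    rw [hH1]
    exact infDist_clip_le hc hne hβ' _
  · intro t ht y hy
    exact ⟨(infDist_segment_clip_le hc hne hβ' y ht).trans hy.1, hdist t ht y hy⟩
  · intro t ht y hy
    have : H (t, y) = y := by simp [H, clip_of_le hc hne hy.1]
    rw [this]
    exact ⟨hy.1, by linarith [hy.2]⟩

lemma HasFedererBound.homologyIncl_thickening (h : HasFedererBound M r) (hc : IsClosed M)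
    (hβ : 0 ≤ β) (hβr : β < r) {x : E} (hx : x ∈ M) {σ : ℝ} (h1 : β < σ) (h2 : σ < 2 * r) :
    HomologyIncl (thickeningSdiffBall M x 0 σ) (thickeningSdiffBall M x β σ) := by
  -- Thickening proceeds in steps of at most d so that the reduced radius stays above β, in the
  -- noncritical range; a single step would need σ - β > β.
  obtain ⟨d, hd0, hd⟩ : ∃ d, 0 < d ∧ β + d < σ := ⟨(σ - β) / 2, by linarith, by linarith⟩
  have key : ∀ k : ℕ, ∀ b, 0 ≤ b → b ≤ β → b ≤ k * d →
      HomologyIncl (thickeningSdiffBall M x 0 σ) (thickeningSdiffBall M x b σ) := by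
    intro k
    induction k with
    | zero =>
      intro b hb _ hb'
      have : b = 0 := le_antisymm (by simpa using hb') hb
      rw [this]
      exact .refl _
    | succ k ih =>
      intro b hb hbβ hb'
      push_cast at hb'
      have hkd : 0 ≤ k * d := by positivity
      set b' := max 0 (b - d) with hb'def
      have h0 : 0 ≤ b' := le_max_left _ _
      have hle : b' ≤ b := max_le hb (by linarith)
      have hge : b - d ≤ b' := le_max_right _ _
      refine (ih b' h0 (by linarith) (max_le (by linarith) (by linarith))).trans ?_
      have e : b' + (b - b') = b := by ring
      have := h.homologyIncl_clip (x := x) (σ := σ) (β' := b') (d := b - b') hc ⟨x, hx⟩ h0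
        (by linarith) (by linarith)
        (h.homologyIncl_radius hc h0 (by linarith) hx (by linarith) (by linarith) h2)
        (h.homologyIncl_radius hc (by linarith) (by linarith) hx (by linarith) (by linarith) h2)
      rwa [e] at this
  obtain ⟨k, hk⟩ := exists_nat_ge (β / d)
  refine key k β hβ le_rfl ?_
  rwa [div_le_iff₀ hd0] at hk

/-- The case σ = 0 of the retraction: balls of nonpositive radius are empty, so the compatibility
conditions are trivial. -/
lemma HasFedererBound.homologyIncl_cthickening (h : HasFedererBound M r) (hc : IsClosed M)
    (hne : M.Nonempty) (hβ : 0 ≤ β) (hβr : β < r) : HomologyIncl M (Metric.cthickening β M) := by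
  obtain ⟨x, hx⟩ := hne
  have e : ∀ γ : ℝ, thickeningSdiffBall M x γ (0 - β) = thickeningSdiffBall M x γ 0 := by
    intro γ
    ext y
    have := dist_nonneg (x := y) (y := x)
    exact and_congr_right fun _ => ⟨fun _ => this, fun _ => by linarith⟩
  have := h.homologyIncl_clip (x := x) (σ := 0) hc ⟨x, hx⟩ le_rfl hβ (by linarith)
    (by rw [e]; exact .refl _) (by rw [e]; exact .refl _)
  rw [zero_add, thickeningSdiffBall_zero hc ⟨x, hx⟩, thickeningSdiffBall_eq ⟨x, hx⟩ hβ] at this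
  simpa using this

/-- If the chords of `M` near `x` are nearly orthogonal to the normals of `M` near `x`, then removing
a small ball about `x` from `M` is as good as removing `x`. -/
lemma HasFedererBound.exists_homologyIncl_point (h : HasFedererBound M r) (hr : 0 < r)
    (hc : IsClosed M) {x : E} (hx : x ∈ M) {R : ℝ} (hR : 0 < R)
    (hchord : ∃ ε > 0, ∀ p ∈ M, ∀ q ∈ M, ∀ z, dist z q = Metric.infDist z M → dist p x < ε →
      dist q x < ε → |inner ℝ (p - x) (z - q)| ≤ 1 / 8 * ‖p - x‖ * ‖z - q‖) :
    ∃ s, 0 < s ∧ s ≤ R ∧ HomologyIncl (thickeningSdiffBall M x 0 s) (M \ {x}) := by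
  have hne : M.Nonempty := ⟨x, hx⟩
  obtain ⟨ε₀, hε₀, hch⟩ := hchord
  -- The projected point q is within 2ε < ε₀ of x, where the chord bound applies; 8ε < r bounds the
  -- Federer term by (ε/4)‖z - q‖.
  obtain ⟨ε, hε, hεε₀, hεr, hεR⟩ : ∃ ε > 0, 2 * ε < ε₀ ∧ 8 * ε < r ∧ ε / 2 ≤ R := by
    obtain ⟨ε, h0, h1⟩ := exists_between (lt_min (lt_min (half_pos hε₀) (by positivity : 0 < r / 8))
      hR)
    rw [lt_min_iff, lt_min_iff] at h1
    exact ⟨ε, h0, by linarith, by linarith, by linarith⟩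
  -- At time 1 the push moves points closer than ε radially onto the sphere of radius ε about x, and
  -- fixes the others.
  let T : ℝ × E → ℝ := fun q => q.1 * (max 1 (ε / dist q.2 x) - 1)
  let H : ℝ × E → E := fun q => clip M 0 (q.2 + T q • (q.2 - x))
  have hT : ∀ t ∈ Set.Icc (0 : ℝ) 1, ∀ y, 0 ≤ T (t, y) := fun t ht y =>
    mul_nonneg ht.1 (sub_nonneg.2 (le_max_left _ _))
  have hinf : ∀ {y}, y ∈ M → Metric.infDist y M ≤ 0 := fun hy =>
    (Metric.infDist_zero_of_mem hy).le
  have hTfar : ∀ t y, y ≠ x → ε ≤ dist y x → T (t, y) = 0 := by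
    intro t y hyx hy
    simp only [T]
    rw [max_eq_left ((div_le_one (dist_pos.2 hyx)).2 hy), sub_self, mul_zero]
  have hTnear : ∀ y, y ≠ x → dist y x ≤ ε → (1 + T (1, y)) * dist y x = ε := by
    intro y hyx hy
    have hpos := dist_pos.2 hyx
    simp only [T]
    rw [max_eq_right ((one_le_div hpos).2 hy)]
    field_simp
    ring
  have hTle : ∀ t ∈ Set.Icc (0 : ℝ) 1, ∀ y, T (t, y) ≤ T (1, y) := by
    intro t ht y
    simp only [T, one_mul]
    exact mul_le_of_le_one_left (sub_nonneg.2 (le_max_left _ _)) ht.2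
  have hreach : ∀ t ∈ Set.Icc (0 : ℝ) 1, ∀ y ∈ M \ {x},
      Metric.infDist (y + T (t, y) • (y - x)) M < r := by
    intro t ht y hy
    have hyx : y ≠ x := hy.2
    rcases le_total ε (dist y x) with hle | hle
    · rw [hTfar t y hyx hle, zero_smul, add_zero, Metric.infDist_zero_of_mem hy.1]
      exact hr
    · refine (Metric.infDist_le_dist_of_mem hx).trans_lt ?_
      rw [dist_push (hT t ht y)]
      have : (1 + T (t, y)) * dist y x ≤ (1 + T (1, y)) * dist y x := by
        have := hTle t ht y
        gcongr
      rw [hTnear y hyx hle] at this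
      linarith
  have hmono : ∀ t ∈ Set.Icc (0 : ℝ) 1, ∀ y ∈ M \ {x}, dist y x ≤ dist (H (t, y)) x :=
    fun t ht y hy => le_dist_clip_push hc hne le_rfl (hT t ht y) (hinf hy.1)
  have hHM : ∀ q, Metric.infDist (H q) M ≤ 0 := fun q => infDist_clip_le hc hne le_rfl _
  have hsub : thickeningSdiffBall M x 0 (ε / 2) ⊆ M \ {x} := by
    rw [thickeningSdiffBall_zero hc hne]
    exact Set.sdiff_subset_sdiff_right
      (Set.singleton_subset_iff.2 (Metric.mem_ball_self (half_pos hε)))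
  refine ⟨ε / 2, half_pos hε, hεR, homologyIncl_of_deformation hsub hsub (.refl _) (.refl _) H
    ?_ ?_ ?_ ?_ ?_⟩
  · refine (h.continuousOn_clip hc hne le_rfl).comp ?_ fun q hq => hreach q.1 hq.1 q.2 hq.2
    have hTc : ContinuousOn T (Set.Icc 0 1 ×ˢ (M \ {x})) := by
      refine continuousOn_fst.mul (ContinuousOn.sub (ContinuousOn.sup continuousOn_const
        (continuousOn_const.div (by fun_prop) fun q hq => ?_)) continuousOn_const)
      exact dist_ne_zero.2 hq.2.2
    exact continuousOn_snd.add (hTc.smul (by fun_prop))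
  · intro y hy
    simp only [H, T, zero_mul, zero_smul, add_zero]
    exact clip_of_le hc hne (hinf hy.1)
  · intro p hp
    refine ⟨hHM _, ?_⟩
    have hone : (1 : ℝ) ∈ Set.Icc (0 : ℝ) 1 := Set.right_mem_Icc.2 zero_le_one
    have hpx : p ≠ x := hp.2
    rcases le_total ε (dist p x) with hle | hle
    · have := hmono 1 hone p hp
      linarith
    set z := p + T (1, p) • (p - x) with hzdef
    have hz : H (1, p) = nearest M z := by simp [H, clip, hzdef]
    rw [hz]
    set q := nearest M z with hq
    have hqM : q ∈ M := nearest_mem hc hne z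
    have hzq : dist z q = Metric.infDist z M := dist_nearest hc hne z
    have hzx : dist z x = ε := by rw [dist_push (hT 1 hone p), hTnear p hpx hle]
    have hzqε : dist z q ≤ ε := by
      rw [hzq, ← hzx]
      exact Metric.infDist_le_dist_of_mem hx
    have hqx : dist q x ≤ 2 * ε := by
      have := dist_triangle_left q x z
      linarith
    have e1 := hch p hp.1 q hqM z hzq (by linarith) (by linarith)
    have e2 := h z q hqM x hx hzq (hreach 1 hone p hp)
    -- Pairing with z - q, Federer's inequality controls the first summand and the chord bound the
    -- second: ‖z - q‖ ≤ ε/4 + ε/8 < ε/2, so q stays at distance at least ε/2 from x.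
    have e3 : z - q = (x - q) + (1 + T (1, p)) • (p - x) := by
      rw [hzdef]
      module
    have e4 : ‖z - q‖ ^ 2 = inner ℝ (x - q) (z - q) + (1 + T (1, p)) * inner ℝ (p - x) (z - q) := by
      rw [← real_inner_self_eq_norm_sq]
      nth_rewrite 1 [e3]
      rw [inner_add_left, inner_smul_left]
      simp
    have hs : 0 ≤ 1 + T (1, p) := by linarith [hT 1 hone p]
    have e5 : (1 + T (1, p)) * inner ℝ (p - x) (z - q) ≤ ε / 8 * ‖z - q‖ := by
      calc (1 + T (1, p)) * inner ℝ (p - x) (z - q)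
          ≤ (1 + T (1, p)) * (1 / 8 * ‖p - x‖ * ‖z - q‖) := by
            gcongr
            exact (le_abs_self _).trans e1
        _ = ((1 + T (1, p)) * dist p x) / 8 * ‖z - q‖ := by rw [dist_eq_norm]; ring
        _ = ε / 8 * ‖z - q‖ := by rw [hTnear p hpx hle]
    have e6 : inner ℝ (x - q) (z - q) ≤ ε / 4 * ‖z - q‖ := by
      have f1 : ‖x - q‖ ^ 2 ≤ (2 * ε) ^ 2 := by
        rw [← dist_eq_norm, dist_comm]
        gcongr
      have f2 : ‖x - q‖ ^ 2 * ‖z - q‖ ≤ (2 * ε) ^ 2 * ‖z - q‖ := by gcongr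
      have f3 := mul_le_mul_of_nonneg_left (le_abs_self (inner ℝ (x - q) (z - q)))
        (by positivity : (0 : ℝ) ≤ 2 * r)
      have f4 : (2 * ε) ^ 2 * ‖z - q‖ ≤ 2 * r * (ε / 4 * ‖z - q‖) := by
        have : 4 * ε * (ε * ‖z - q‖) ≤ (r / 2) * (ε * ‖z - q‖) := by
          gcongr
          linarith
        linarith
      exact le_of_mul_le_mul_left (by linarith) (by positivity : (0 : ℝ) < 2 * r)
    have e7 : ‖z - q‖ ≤ ε / 2 := by
      by_contra! hlt
      nlinarith
    have := dist_triangle z q x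
    rw [dist_eq_norm z q] at this
    linarith
  · intro t ht y hy
    refine ⟨hc.mem_iff_infDist_zero hne |>.2 (le_antisymm (hHM _) Metric.infDist_nonneg), ?_⟩
    have := (dist_pos.2 (show y ≠ x from hy.2)).trans_le (hmono t ht y hy)
    exact dist_pos.1 this
  · intro t ht y hy
    exact ⟨hHM _, hy.2.trans (hmono t ht y (hsub hy))⟩

end Neighbourhoods

/-! ### Normal vectors of submanifolds -/

section Charts

variable {E : Type*} [NormedAddCommGroup E] [InnerProductSpace ℝ E] {M : Set E}
  {Φ : OpenPartialHomeomorph E E} {W : Submodule ℝ E}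

lemma hasFDerivAt_of_contDiffOn {F : Type*} [NormedAddCommGroup F] [NormedSpace ℝ F] {f : E → F}
    {s : Set E} (hs : IsOpen s) (hf : ContDiffOn ℝ ∞ f s) {y : E} (hy : y ∈ s) :
    HasFDerivAt f (fderiv ℝ f y) y :=
  ((hf.contDiffAt (hs.mem_nhds hy)).differentiableAt (by simp)).hasFDerivAt

/-- First variation: the segment from a point to its nearest point in `M` is normal to `M`. -/
lemma inner_fderiv_symm_eq_zero (hΦ' : ContDiffOn ℝ ∞ Φ.symm Φ.target)
    (hW : ∀ y ∈ Φ.source, y ∈ M ↔ Φ y ∈ W) {q z : E} (hq : q ∈ M) (hqs : q ∈ Φ.source)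
    (hz : dist z q = Metric.infDist z M) {w : E} (hw : w ∈ W) :
    inner ℝ (fderiv ℝ Φ.symm (Φ q) w) (z - q) = 0 := by
  -- `Φ.symm ∘ γ` runs in M near time 0, and its squared distance to z is minimal at time 0.
  let γ : ℝ → E := fun s => Φ q + s • w
  have hγ0 : γ 0 = Φ q := by simp [γ]
  have hγ : HasDerivAt γ w 0 := by
    have := ((hasDerivAt_id (0 : ℝ)).smul_const w).const_add (Φ q)
    rwa [one_smul] at this
  have hΨ : HasFDerivAt Φ.symm (fderiv ℝ Φ.symm (Φ q)) (γ 0) := by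
    rw [hγ0]
    exact hasFDerivAt_of_contDiffOn Φ.open_target hΦ' (Φ.map_source hqs)
  have hd := ((hΨ.comp_hasDerivAt (0 : ℝ) hγ).const_sub z).norm_sq
  have hmin : IsLocalMin (fun s => ‖z - (Φ.symm ∘ γ) s‖ ^ 2) 0 := by
    have hev : ∀ᶠ s in 𝓝 (0 : ℝ), γ s ∈ Φ.target :=
      hγ.continuousAt.eventually_mem (by
        rw [hγ0]
        exact Φ.open_target.mem_nhds (Φ.map_source hqs))
    filter_upwards [hev] with s hs
    have hsM : Φ.symm (γ s) ∈ M := by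
      rw [hW _ (Φ.map_target hs), Φ.right_inv hs]
      exact W.add_mem ((hW q hqs).1 hq) (W.smul_mem _ hw)
    have : dist z q ≤ dist z (Φ.symm (γ s)) := hz ▸ Metric.infDist_le_dist_of_mem hsM
    rw [dist_eq_norm, dist_eq_norm] at this
    simp only [Function.comp_apply, hγ0, Φ.left_inv hqs]
    gcongr
  have h0 := hmin.hasDerivAt_eq_zero hd
  simp only [Function.comp_apply, hγ0, Φ.left_inv hqs, inner_neg_right, mul_neg, neg_eq_zero,
    mul_eq_zero, OfNat.ofNat_ne_zero, false_or] at h0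
  rw [real_inner_comm]
  exact h0

/-- The differential of Φ sends tangent vectors of M into the tangent cone of W, which lies in W
because W is a closed subspace; the chain rule inverts it. -/
lemma exists_eq_fderiv_symm_of_mem_tangentConeAt [FiniteDimensional ℝ E]
    (hΦ : ContDiffOn ℝ ∞ Φ Φ.source) (hΦ' : ContDiffOn ℝ ∞ Φ.symm Φ.target)
    (hW : ∀ y ∈ Φ.source, y ∈ M ↔ Φ y ∈ W) {q w : E} (hqs : q ∈ Φ.source)
    (hq : q ∈ M) (hw : w ∈ tangentConeAt ℝ M q) : ∃ u ∈ W, w = fderiv ℝ Φ.symm (Φ q) u := by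
  have hd := hasFDerivAt_of_contDiffOn Φ.open_source hΦ hqs
  have hd' := hasFDerivAt_of_contDiffOn Φ.open_target hΦ' (Φ.map_source hqs)
  refine ⟨fderiv ℝ Φ q w, ?_, ?_⟩
  · rw [← tangentConeAt_inter_nhds (Φ.open_source.mem_nhds hqs)] at hw
    have h1 := hd.hasFDerivWithinAt.mapsTo_tangent_cone hw
    have h2 := tangentConeAt_mono (𝕜 := ℝ) (x := Φ q)
      (show Φ '' (M ∩ Φ.source) ⊆ W from by
        rintro _ ⟨y, hy, rfl⟩
        exact (hW y hy.2).1 hy.1) h1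
    obtain ⟨ι, l, hl, c, d, -, hdW, hlim⟩ := exists_fun_of_mem_tangentConeAt h2
    refine W.closed_of_finiteDimensional.mem_of_tendsto hlim ?_
    filter_upwards [hdW] with i hi
    exact W.smul_mem _ ((W.add_mem_iff_right ((hW q hqs).1 hq)).1 hi)
  · have hcomp := hd'.comp q hd
    have hid : HasFDerivAt (Φ.symm ∘ Φ) (ContinuousLinearMap.id ℝ E) q := by
      refine (hasFDerivAt_id q).congr_of_eventuallyEq ?_
      filter_upwards [Φ.open_source.mem_nhds hqs] with y hy
      exact Φ.left_inv hy
    exact (congrArg (fun L : E →L[ℝ] E => L w) (hcomp.unique hid)).symm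

lemma IsSmoothSubmanifold.inner_eq_zero [FiniteDimensional ℝ E] (hM : IsSmoothSubmanifold M)
    {q z w : E} (hq : q ∈ M) (hz : dist z q = Metric.infDist z M)
    (hw : w ∈ tangentConeAt ℝ M q) : inner ℝ w (z - q) = 0 := by
  obtain ⟨Φ, W, hqs, hΦ, hΦ', hW⟩ := hM q hq
  obtain ⟨u, hu, rfl⟩ := exists_eq_fderiv_symm_of_mem_tangentConeAt hΦ hΦ' hW hqs hq hw
  exact inner_fderiv_symm_eq_zero hΦ' hW hq hqs hz hu

/-- Chords of `M` near `x` are nearly orthogonal to normals of `M` near `x`. -/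
lemma IsSmoothSubmanifold.exists_abs_inner_le (hM : IsSmoothSubmanifold M) {x : E} (hx : x ∈ M)
    {η : ℝ} (hη : 0 < η) :
    ∃ ε > 0, ∀ p ∈ M, ∀ q ∈ M, ∀ z, dist z q = Metric.infDist z M → dist p x < ε →
      dist q x < ε → |inner ℝ (p - x) (z - q)| ≤ η * ‖p - x‖ * ‖z - q‖ := by
  obtain ⟨Φ, W, hxs, hΦ, hΦ', hW⟩ := hM x hx
  have hΦx := hΦ.contDiffAt (Φ.open_source.mem_nhds hxs)
  have hΨx := hΦ'.contDiffAt (Φ.open_target.mem_nhds (Φ.map_source hxs))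
  have hΦc : ContinuousAt Φ x := hΦx.continuousAt
  obtain ⟨K, V, hV, hK⟩ := (hΦx.of_le (m := 1) (by simp)).exists_lipschitzOnWith
  have hL : HasFDerivAt Φ.symm (fderiv ℝ Φ.symm (Φ x)) (Φ x) :=
    hasFDerivAt_of_contDiffOn Φ.open_target hΦ' (Φ.map_source hxs)
  have hLc : ContinuousAt (fderiv ℝ Φ.symm) (Φ x) :=
    (hΨx.fderiv_right (m := 0) (by simp)).continuousAt
  set κ := η / (2 * (K + 1)) with hκ
  have hκ0 : 0 < κ := by positivity
  have ev1 : ∀ᶠ p in 𝓝 x, p ∈ Φ.source ∧ p ∈ V ∧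
      ‖Φ.symm (Φ p) - Φ.symm (Φ x) - fderiv ℝ Φ.symm (Φ x) (Φ p - Φ x)‖ ≤ κ * ‖Φ p - Φ x‖ :=
    (Φ.open_source.eventually_mem hxs).and
      ((Filter.eventually_mem_set.2 hV).and (hΦc.eventually (hL.isLittleO.def hκ0)))
  have ev2 : ∀ᶠ q in 𝓝 x, q ∈ Φ.source ∧
      dist (fderiv ℝ Φ.symm (Φ q)) (fderiv ℝ Φ.symm (Φ x)) < κ :=
    (Φ.open_source.eventually_mem hxs).and
      ((hLc.comp hΦc).eventually (Metric.ball_mem_nhds _ hκ0))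
  obtain ⟨ε, hε, hball⟩ := Metric.eventually_nhds_iff.1 (ev1.and ev2)
  refine ⟨ε, hε, fun p hp q hq z hz hpx hqx => ?_⟩
  obtain ⟨hps, hpV, hp1⟩ := (hball hpx).1
  obtain ⟨hqs, hq1⟩ := (hball hqx).2
  rw [Φ.left_inv hps, Φ.left_inv hxs] at hp1
  rw [dist_eq_norm] at hq1
  have hlip : ‖Φ p - Φ x‖ ≤ K * ‖p - x‖ := by
    simpa [dist_eq_norm] using hK.dist_le_mul p hpV x (mem_of_mem_nhds hV)
  have hperp : inner ℝ (fderiv ℝ Φ.symm (Φ q) (Φ p - Φ x)) (z - q) = 0 :=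
    inner_fderiv_symm_eq_zero hΦ' hW hq hqs hz
      (W.sub_mem ((hW p hps).1 hp) ((hW x hxs).1 hx))
  -- The subtracted vector is tangent at q, so only e pairs with z - q. Its two errors,
  -- linearization at x and variation of the differential from x to q, are each at most (η/2)‖p - x‖
  -- by the choice of κ.
  set e := p - x - fderiv ℝ Φ.symm (Φ q) (Φ p - Φ x) with he
  have hin : inner ℝ (p - x) (z - q) = inner ℝ e (z - q) := by
    rw [he, inner_sub_left (p - x), hperp, sub_zero]
  have hsplit : e = (p - x - fderiv ℝ Φ.symm (Φ x) (Φ p - Φ x)) -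
      (fderiv ℝ Φ.symm (Φ q) - fderiv ℝ Φ.symm (Φ x)) (Φ p - Φ x) := by
    rw [he, sub_apply]
    abel
  have hle : ‖e‖ ≤ η * ‖p - x‖ := by
    calc ‖e‖ ≤ κ * ‖Φ p - Φ x‖ + κ * ‖Φ p - Φ x‖ := by
          rw [hsplit]
          refine (norm_sub_le _ _).trans (add_le_add hp1 ?_)
          exact (ContinuousLinearMap.le_opNorm _ _).trans (by gcongr)
      _ ≤ κ * ((K + 1) * ‖p - x‖) + κ * ((K + 1) * ‖p - x‖) := by
          have : ‖Φ p - Φ x‖ ≤ (K + 1) * ‖p - x‖ := by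
            linarith [norm_nonneg (p - x)]
          gcongr
      _ = η * ‖p - x‖ := by
          rw [hκ]
          field_simp
          ring
  rw [hin]
  exact (abs_real_inner_le_norm _ _).trans (by gcongr)

/-- An embedded normal bundle yields the two-sided Federer inequality. -/
lemma IsSmoothSubmanifold.hasFedererBound [FiniteDimensional ℝ E] (hM : IsSmoothSubmanifold M)
    (hc : IsClosed M) {r r' : ℝ} (hr : r < r')
    (hinj : Set.InjOn (fun q : E × E => q.1 + q.2) (normalBundle M r')) :
    HasFedererBound M r := by
  intro z q hq m hm hz hzr
  have : ProperSpace E := FiniteDimensional.proper_real E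
  have key : ∀ k : ℝ, ‖k • (z - q)‖ < r' → 2 * (k * inner ℝ (m - q) (z - q)) ≤ ‖m - q‖ ^ 2 := by
    intro k hk
    set y := q + k • (z - q) with hy
    obtain ⟨q', hq', hyq'⟩ : ∃ q' ∈ M, dist y q' = Metric.infDist y M :=
      ⟨_, nearest_mem hc ⟨q, hq⟩ y, dist_nearest hc ⟨q, hq⟩ y⟩
    have hle : dist y q' ≤ ‖k • (z - q)‖ := by
      rw [hyq']
      refine (Metric.infDist_le_dist_of_mem hq).trans_eq ?_
      rw [dist_eq_norm, hy, add_sub_cancel_left]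
    have h1 : (q', y - q') ∈ normalBundle M r' :=
      ⟨hq', fun w hw => hM.inner_eq_zero hq' hyq' hw, by
        rw [← dist_eq_norm]
        exact hle.trans_lt hk⟩
    have h2 : (q, k • (z - q)) ∈ normalBundle M r' :=
      ⟨hq, fun w hw => by rw [inner_smul_right, hM.inner_eq_zero hq hz hw, mul_zero], hk⟩
    have h3 : q' = q := congrArg Prod.fst (hinj h1 h2 (by simp [hy]))
    rw [h3] at hyq'
    have h4 : dist y q ≤ dist y m := hyq' ▸ Metric.infDist_le_dist_of_mem hm
    have h5 : y - m = k • (z - q) - (m - q) := by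
      rw [hy]
      abel
    rw [dist_eq_norm, dist_eq_norm, h5, hy, add_sub_cancel_left] at h4
    have h6 : ‖k • (z - q)‖ ^ 2 ≤ ‖k • (z - q) - (m - q)‖ ^ 2 := by gcongr
    rw [norm_sub_sq_real, inner_smul_left, real_inner_comm] at h6
    simp only [conj_trivial] at h6
    linarith
  rcases (norm_nonneg (z - q)).eq_or_lt with h0 | h0
  · rw [norm_eq_zero.1 h0.symm]
    simp
  have hr0 : 0 < r := Metric.infDist_nonneg.trans_lt hzr
  have hkey : ∀ k : ℝ, |k| = r / ‖z - q‖ → 2 * (k * inner ℝ (m - q) (z - q)) ≤ ‖m - q‖ ^ 2 :=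
    fun k hk => key k (by rwa [norm_smul, Real.norm_eq_abs, hk, div_mul_cancel₀ _ h0.ne'])
  have hpos : 0 < r / ‖z - q‖ := by positivity
  have h1 := hkey (r / ‖z - q‖) (abs_of_pos hpos)
  -- The normal fibre is symmetric, so the opposite tangent ball misses M too; this yields the
  -- absolute value.
  have h2 := hkey (-(r / ‖z - q‖)) (by rw [abs_neg, abs_of_pos hpos])
  have h3 : 2 * (r / ‖z - q‖) * |inner ℝ (m - q) (z - q)| ≤ ‖m - q‖ ^ 2 := by
    rcases abs_cases (inner ℝ (m - q) (z - q)) with ⟨h, -⟩ | ⟨h, -⟩ <;> rw [h] <;> linarith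
  calc 2 * r * |inner ℝ (m - q) (z - q)|
      = 2 * (r / ‖z - q‖) * |inner ℝ (m - q) (z - q)| * ‖z - q‖ := by field_simp
    _ ≤ _ := by gcongr

/-- A radius below the reach at which Federer's inequality holds. -/
lemma IsSmoothSubmanifold.exists_hasFedererBound [FiniteDimensional ℝ E]
    (hM : IsSmoothSubmanifold M) (hc : IsClosed M) {s : ℝ} (hs : (s : EReal) < reach M) :
    ∃ r, s < r ∧ HasFedererBound M r := by
  obtain ⟨_, ⟨r', -, hr', rfl⟩, hsr⟩ := lt_sSup_iff.1 hs
  -- r lies strictly below r' because normal vectors of length exactly r must lie in the open bundle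
  -- of radius r'.
  obtain ⟨r, hsr, hrr'⟩ := exists_between (EReal.coe_lt_coe_iff.1 hsr)
  exact ⟨r, hsr, hM.hasFedererBound hc hrr' (Set.injOn_iff_injective.2 hr'.1.injective)⟩

end Charts

end ReachHom

end

theorem mainTheorem11 (n : ℕ) (M : Set (EuclideanSpace ℝ (Fin n)))
    (hM : ReachHom.IsSmoothSubmanifold M) (hclosed : IsClosed M)
    (α : ℝ) (hα : 0 < α) (hα' : (α : EReal) < ReachHom.reach M)
    (ρ : ℝ) (hρ : α < ρ) (hρ' : (ρ : EReal) < 2 * ReachHom.reach M - (α : EReal))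
    (x : EuclideanSpace ℝ (Fin n)) (hx : x ∈ M) (l : ℕ) :
    IsIso (ReachHom.relHomologyMap l
      (ReachHom.pairBallIncl M (Metric.cthickening α M) (Metric.self_subset_cthickening M) x ρ)) ∧
    IsIso (ReachHom.relHomologyMap l
      (ReachHom.pairBallToPoint M x (hα.trans hρ))) := by
  open ReachHom in
  have hne : M.Nonempty := ⟨x, hx⟩
  -- r > α makes the projection continuous on D_α; r > ρ/2 puts ρ in the noncritical range below 2r.
  have hhalf : ((max α (ρ / 2) : ℝ) : EReal) < reach M := by
    rcases max_choice α (ρ / 2) with h | h <;> rw [h]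
    · exact hα'
    generalize reach M = R at hα' hρ'
    induction R with
    | bot => simp at hα'
    | top => exact EReal.coe_lt_top _
    | coe R =>
      rw [show (2 : EReal) = ((2 : ℝ) : EReal) from rfl, ← EReal.coe_mul, ← EReal.coe_sub,
        EReal.coe_lt_coe_iff] at hρ'
      rw [EReal.coe_lt_coe_iff]
      linarith
  obtain ⟨r, hr, hF⟩ := hM.exists_hasFedererBound hclosed hhalf
  have hαr : α < r := (le_max_left _ _).trans_lt hr
  have hρr : ρ < 2 * r := by linarith [le_max_right α (ρ / 2)]
  have hr0 : 0 < r := hα.trans hαr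
  have hρ0 : 0 < ρ := hα.trans hρ
  have hball : HomologyIncl (M \ Metric.ball x ρ) (Metric.cthickening α M \ Metric.ball x ρ) := by
    rw [← thickeningSdiffBall_zero hclosed hne, ← thickeningSdiffBall_eq hne hα.le]
    exact hF.homologyIncl_thickening hclosed hα.le hαr hx hρ hρr
  have hpoint : HomologyIncl (M \ Metric.ball x ρ) (M \ {x}) := by
    obtain ⟨s, hs0, hsρ, hs⟩ := hF.exists_homologyIncl_point hr0 hclosed hx hρ0
      (hM.exists_abs_inner_le hx (by norm_num))
    rw [← thickeningSdiffBall_zero hclosed hne]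
    exact (hF.homologyIncl_radius hclosed le_rfl hr0 hx hs0 hsρ hρr).trans hs
  exact ⟨isIso_relHomologyMap_subsetPairIncl _ _
      (hF.homologyIncl_cthickening hclosed hne hα.le hαr) hball l,
    isIso_relHomologyMap_subsetPairIncl _ _ (.refl M) hpoint l⟩
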